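/- Let $\mathbb K$ be a field of characteristic $0$. A dendriform algebra is a $\mathbb K$-vector space $D$ with bilinear operations $\prec,\succ$ such that $(a\prec b)\prec c=a\prec(b\prec c+b\succ c)$, $(a\succ b)\prec c=a\succ(b\prec c)$ and $(a\prec b+a\succ b)\succ c=a\succ(b\succ c)$; it is involutive if it carries a linear map $*$ with $a^{**}=a$ and $(a\prec b)^*=b^*\succ a^*$. A Rota--Baxter algebra is a (nonunitary) associative algebra $A$ with a linear map $R:A\to A$ such that $R(a)R(b)=R(aR(b)+R(a)b)$; it is involutive if it carries a linear map $*$ with $a^{**}=a$, $(ab)^*=b^*a^*$ and $R(a)^*=R(a^*)$. Let $B$ be a nonunitary associative algebra with basis $X$. The Rota--Baxter words over $X$ are the non-empty finite words whose letters are alternately elements of $X$ and bracketed words $\lfloor w\rfloor$ with $w$ again a Rota--Baxter word. Let $\varpi^{\mathrm{NC},0}(B)$ be the vector space with basis all Rota--Baxter words, with $R_B(w)=\lfloor w\rfloor$ and with the bilinear product $\diamond$ given recursively on words by $$x_1\cdots x_m\diamond y_1\cdots y_n=x_1\cdots x_{m-1}(x_m\diamond y_1)y_2\cdots y_n ,$$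 where for single letters $x\diamond y$ is the product in $B$ if $x,y\in X$, the concatenation $xy$ if exactly one of $x,y$ lies in $X$, and $\lfloor u\rfloor\diamond\lfloor v\rfloor=\lfloor\lfloor u\rfloor\diamond v\rfloor+\lfloor u\diamond\lfloor v\rfloor\rfloor$. An involution of $B$ induces the linear map $*$ on $\varpi^{\mathrm{NC},0}(B)$ given by the involution of $B$ on $X$, $\lfloor w\rfloor^*=\lfloor w^*\rfloor$ and $(x_1\cdots x_m)^*=x_m^*\cdots x_1^*$ (extended multilinearly). Let $(D,\prec,\succ,*)$ be an involutive dendriform algebra, let $T(D)=\bigoplus_{n\ge1}D^{\otimes n}$ be the nonunitary tensor algebra with the involution $(v_1\otimes\cdots\otimes v_n)^*=v_n^*\otimes\cdots\otimes v_1^*$, and form $\varpi^{\mathrm{NC},0}(T(D))$ with respect to any basis of $T(D)$. Let $J_R\subset\varpi^{\mathrm{NC},0}(T(D))$ be the Rota--Baxter ideal (the smallest two-sided ideal stable under $R_{T(D)}$) generated by the elements $x\prec y-x\diamond\lfloor y\rfloor$ and $x\succ y-\lfloor x\rfloor\diamond y$ for $x,y\in D$. Then: 1. $(\varpi^{\mathrm{NC},0}(T(D)),\diamond,R_{T(D)},*)$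 is an involutive Rota--Baxter algebra; 2. $J_R$ is stable under $*$; 3. the universal enveloping Rota--Baxter algebra $\varpi^{\mathrm{NC},0}(T(D))/J_R$ of $D$, with the product and the operator induced from $\varpi^{\mathrm{NC},0}(T(D))$, inherits an involution: there is a unique linear map $*$ on it with $[z]^*=[z^*]$ for all $z\in\varpi^{\mathrm{NC},0}(T(D))$ that makes it an involutive Rota--Baxter algebra. -/

import Mathlib

noncomputable section

/-! ### Dendriform and Rota-Baxter algebras

A nonunitary algebra is a vector space with a bilinear product `μ : A →ₗ[K] A →ₗ[K] A`;
involutions are `K`-linear maps. -/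

/-- `(D, ≺, ≻)` is a dendriform algebra. -/
structure IsDendriform {K D : Type*} [Field K] [AddCommGroup D] [Module K D]
    (prec succ : D →ₗ[K] D →ₗ[K] D) : Prop where
  prec_prec : ∀ a b c, prec (prec a b) c = prec a (prec b c + succ b c)
  succ_prec : ∀ a b c, prec (succ a b) c = succ a (prec b c)
  succ_succ : ∀ a b c, succ (prec a b + succ a b) c = succ a (succ b c)

/-- `(D, ≺, ≻, *)` is an involutive dendriform algebra. -/
structure IsInvolutiveDendriform {K D : Type*} [Field K] [AddCommGroup D] [Module K D]
    (prec succ : D →ₗ[K] D →ₗ[K] D) (str : D →ₗ[K] D) : Prop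
    extends IsDendriform prec succ where
  star_star : ∀ a, str (str a) = a
  star_prec : ∀ a b, str (prec a b) = succ (str b) (str a)

/-- `(A, μ, R)` is a (nonunitary, associative) Rota-Baxter algebra (of weight zero). -/
structure IsRotaBaxterAlgebra {K A : Type*} [Field K] [AddCommGroup A] [Module K A]
    (μ : A →ₗ[K] A →ₗ[K] A) (R : A →ₗ[K] A) : Prop where
  mul_assoc : ∀ a b c, μ (μ a b) c = μ a (μ b c)
  rotaBaxter : ∀ a b, μ (R a) (R b) = R (μ a (R b) + μ (R a) b)

/-- `(A, μ, R, *)` is a (nonunitary) involutive Rota-Baxter algebra. -/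
structure IsInvolutiveRotaBaxterAlgebra {K A : Type*} [Field K] [AddCommGroup A] [Module K A]
    (μ : A →ₗ[K] A →ₗ[K] A) (R : A →ₗ[K] A) (str : A →ₗ[K] A) : Prop
    extends IsRotaBaxterAlgebra μ R where
  star_star : ∀ a, str (str a) = a
  star_mul : ∀ a b, str (μ a b) = μ (str b) (str a)
  star_op : ∀ a, str (R a) = R (str a)

/-- Rota-Baxter ideals: two-sided ideals that are stable under the operator. -/
structure IsRotaBaxterIdeal {K A : Type*} [Field K] [AddCommGroup A] [Module K A]
    (μ : A →ₗ[K] A →ₗ[K] A) (R : A →ₗ[K] A) (I : Submodule K A) : Prop where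
  mul_left_mem : ∀ a, ∀ x ∈ I, μ a x ∈ I
  mul_right_mem : ∀ a, ∀ x ∈ I, μ x a ∈ I
  op_mem : ∀ x ∈ I, R x ∈ I

/-- The Rota-Baxter ideal generated by a set. -/
def rotaBaxterIdealSpan {K A : Type*} [Field K] [AddCommGroup A] [Module K A]
    (μ : A →ₗ[K] A →ₗ[K] A) (R : A →ₗ[K] A) (S : Set A) : Submodule K A :=
  sInf {I : Submodule K A | IsRotaBaxterIdeal μ R I ∧ S ⊆ I}

theorem isRotaBaxterIdeal_span {K A : Type*} [Field K] [AddCommGroup A] [Module K A]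
    (μ : A →ₗ[K] A →ₗ[K] A) (R : A →ₗ[K] A) (S : Set A) :
    IsRotaBaxterIdeal μ R (rotaBaxterIdealSpan μ R S) := by
  refine ⟨fun a x hx => ?_, fun a x hx => ?_, fun x hx => ?_⟩ <;>
    · rw [rotaBaxterIdealSpan, Submodule.mem_sInf] at hx ⊢
      intro I hI
      first
        | exact hI.1.mul_left_mem a x (hx I hI)
        | exact hI.1.mul_right_mem a x (hx I hI)
        | exact hI.1.op_mem x (hx I hI)

/-- The product induced on the quotient by a Rota-Baxter ideal. -/
def quotientMul {K A : Type*} [Field K] [AddCommGroup A] [Module K A]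
    {μ : A →ₗ[K] A →ₗ[K] A} {R : A →ₗ[K] A} {I : Submodule K A}
    (hI : IsRotaBaxterIdeal μ R I) : (A ⧸ I) →ₗ[K] (A ⧸ I) →ₗ[K] (A ⧸ I) :=
  I.liftQ
    ((Submodule.mapQLinear I I).comp
      (μ.codRestrict (Submodule.compatibleMaps I I) fun a x hx => hI.mul_left_mem a x hx))
    (by
      intro x hx
      rw [LinearMap.mem_ker]
      ext a
      exact (Submodule.Quotient.mk_eq_zero I).2 (hI.mul_right_mem a x hx))

theorem quotientMul_mk {K A : Type*} [Field K] [AddCommGroup A] [Module K A]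
    {μ : A →ₗ[K] A →ₗ[K] A} {R : A →ₗ[K] A} {I : Submodule K A}
    (hI : IsRotaBaxterIdeal μ R I) (a b : A) :
    quotientMul hI (I.mkQ a) (I.mkQ b) = I.mkQ (μ a b) := rfl

/-- The operator induced on the quotient by a Rota-Baxter ideal. -/
def quotientOp {K A : Type*} [Field K] [AddCommGroup A] [Module K A]
    {μ : A →ₗ[K] A →ₗ[K] A} {R : A →ₗ[K] A} {I : Submodule K A}
    (hI : IsRotaBaxterIdeal μ R I) : (A ⧸ I) →ₗ[K] (A ⧸ I) :=
  I.mapQ I R fun x hx => hI.op_mem x hx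

theorem quotientOp_mk {K A : Type*} [Field K] [AddCommGroup A] [Module K A]
    {μ : A →ₗ[K] A →ₗ[K] A} {R : A →ₗ[K] A} {I : Submodule K A}
    (hI : IsRotaBaxterIdeal μ R I) (a : A) :
    quotientOp hI (I.mkQ a) = I.mkQ (R a) := rfl

/-! ### Rota-Baxter words -/

/-- Rota-Baxter words over `X` with prescribed head: words whose letters are alternately elements
of `X` and bracketed Rota-Baxter words `⌊w⌋`. The index is the head: `false` if the first letter
is in `X`, `true` if it is bracketed. -/
inductive RBWord (X : Type*) : Bool → Type _
  /-- the word `x` -/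
  | var (x : X) : RBWord X false
  /-- the word `⌊u⌋` -/
  | brak {h : Bool} (u : RBWord X h) : RBWord X true
  /-- the word `x w`, where `w` begins with a bracket -/
  | varCons (x : X) (w : RBWord X true) : RBWord X false
  /-- the word `⌊u⌋ w`, where `w` begins with an element of `X` -/
  | brakCons {h : Bool} (u : RBWord X h) (w : RBWord X false) : RBWord X true

section FreeRB

variable {K B X : Type*} [Field K] [NonUnitalRing B] [Module K B]

/-- The product `x ⋄ x'` of two Rota-Baxter words over a basis `X` of `B`, a linear combination of
words with the same head as `x`. All letters of `x` but the last and all letters of `x'` but the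
first are kept; the last letter of `x` and the first letter of `x'` are multiplied by the rules
`a ⋄ b = a · b` (product in `B`), concatenation if exactly one of them is bracketed, and
`⌊u⌋ ⋄ ⌊v⌋ = ⌊⌊u⌋ ⋄ v⌋ + ⌊u ⋄ ⌊v⌋⌋`. -/
def RBWord.mul (b : Module.Basis X K B) :
    {h h' : Bool} → RBWord X h → RBWord X h' → (RBWord X h →₀ K)
  | _, _, .varCons x w, y => (RBWord.mul b w y).mapDomain (.varCons x)
  | _, _, .brakCons u w, y => (RBWord.mul b w y).mapDomain (.brakCons u)
  | _, true, .var x, y => Finsupp.single (.varCons x y) 1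
  | _, _, .var x, .var y => (b.repr (b x * b y)).mapDomain .var
  | _, _, .var x, .varCons y w => (b.repr (b x * b y)).mapDomain fun z => .varCons z w
  | _, false, .brak u, y => Finsupp.single (.brakCons u y) 1
  | _, _, .brak u, .brak v =>
      (RBWord.mul b (.brak u) v).mapDomain .brak + (RBWord.mul b u (.brak v)).mapDomain .brak
  | _, _, .brak u, .brakCons v w =>
      (RBWord.mul b (.brak u) v).mapDomain (fun z => .brakCons z w) +
        (RBWord.mul b u (.brak v)).mapDomain (fun z => .brakCons z w)
termination_by _ _ x y => sizeOf x + sizeOf y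

/-- The vector space `ϖ^{NC,0}(B)` with basis all Rota-Baxter words over the basis `b` of `B`. -/
def FreeRB (_b : Module.Basis X K B) : Type _ := (Σ h : Bool, RBWord X h) →₀ K

instance (b : Module.Basis X K B) : AddCommGroup (FreeRB b) :=
  inferInstanceAs (AddCommGroup ((Σ h : Bool, RBWord X h) →₀ K))

instance (b : Module.Basis X K B) : Module K (FreeRB b) :=
  inferInstanceAs (Module K ((Σ h : Bool, RBWord X h) →₀ K))

namespace FreeRB

/-- The basis of `ϖ^{NC,0}(B)` given by the Rota-Baxter words. -/
def wordBasis (b : Module.Basis X K B) : Module.Basis (Σ h : Bool, RBWord X h) K (FreeRB b) :=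
  Module.Basis.ofRepr (LinearEquiv.refl K ((Σ h : Bool, RBWord X h) →₀ K))

/-- The product `⋄`, the bilinear extension of the product of words. -/
def mul (b : Module.Basis X K B) : FreeRB b →ₗ[K] FreeRB b →ₗ[K] FreeRB b :=
  (wordBasis b).constr K fun x => (wordBasis b).constr K fun y =>
    (RBWord.mul b x.2 y.2).sum fun w c => c • wordBasis b ⟨x.1, w⟩

/-- The operator `R_B`, the linear extension of `x ↦ ⌊x⌋`. -/
def op (b : Module.Basis X K B) : FreeRB b →ₗ[K] FreeRB b :=
  (wordBasis b).constr K fun x => wordBasis b ⟨true, .brak x.2⟩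

/-- The inclusion `j_B : B → ϖ^{NC,0}(B)`, the linear extension of the inclusion of `X`. -/
def incl (b : Module.Basis X K B) : B →ₗ[K] FreeRB b :=
  b.constr K fun x => wordBasis b ⟨false, .var x⟩

/-- The involution on words induced by an involution `σ` of `B`: `x ↦ σ x` for `x ∈ X`,
`⌊u⌋* = ⌊u*⌋` and `(x₁ ⋯ xₙ)* = xₙ* ⋯ x₁*`. In the products on the right `⋄` is concatenation
because letters of the two kinds alternate. -/
def wordStar (b : Module.Basis X K B) (σ : B →ₗ[K] B) : {h : Bool} → RBWord X h → FreeRB b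
  | _, .var x => incl b (σ (b x))
  | _, .brak u => op b (wordStar b σ u)
  | _, .varCons x w => mul b (wordStar b σ w) (incl b (σ (b x)))
  | _, .brakCons u w => mul b (wordStar b σ w) (op b (wordStar b σ u))

/-- The involution on `ϖ^{NC,0}(B)` induced by an involution `σ` of `B`. -/
def inv (b : Module.Basis X K B) (σ : B →ₗ[K] B) : FreeRB b →ₗ[K] FreeRB b :=
  (wordBasis b).constr K fun x => wordStar b σ x.2

end FreeRB

end FreeRB

/-! ### The nonunitary tensor algebra -/

section RedTensor

variable (K : Type*) {D : Type*} [Field K] [AddCommGroup D] [Module K D]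

/-- `T(D) = ⨁_{n ≥ 1} D^{⊗ n}`, as the nonunitary subalgebra of the unital tensor algebra that is
generated by `D`. -/
abbrev RedTensor (D : Type*) [AddCommGroup D] [Module K D] :
    NonUnitalSubalgebra K (TensorAlgebra K D) :=
  NonUnitalAlgebra.adjoin K (Set.range (TensorAlgebra.ι K : D → TensorAlgebra K D))

/-- The inclusion `D → T(D)`. -/
def RedTensor.incl : D →ₗ[K] RedTensor K D :=
  (TensorAlgebra.ι K).codRestrict (RedTensor K D).toSubmodule
    fun x => NonUnitalAlgebra.subset_adjoin K ⟨x, rfl⟩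

variable {K}

/-- The linear map of the unital tensor algebra with
`v₁ ⊗ ⋯ ⊗ vₙ ↦ vₙ* ⊗ ⋯ ⊗ v₁*`. -/
def tensorStar (str : D →ₗ[K] D) : TensorAlgebra K D →ₗ[K] TensorAlgebra K D :=
  (MulOpposite.opLinearEquiv K).symm.toLinearMap ∘ₗ
    (TensorAlgebra.lift K
      ((MulOpposite.opLinearEquiv K).toLinearMap ∘ₗ TensorAlgebra.ι K ∘ₗ str)).toLinearMap

theorem tensorStar_ι (str : D →ₗ[K] D) (v : D) :
    tensorStar str (TensorAlgebra.ι K v) = TensorAlgebra.ι K (str v) := by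
  simp [tensorStar]

theorem tensorStar_mul (str : D →ₗ[K] D) (a b : TensorAlgebra K D) :
    tensorStar str (a * b) = tensorStar str b * tensorStar str a := by
  simp [tensorStar]

theorem tensorStar_mem (str : D →ₗ[K] D) (a : TensorAlgebra K D) (ha : a ∈ RedTensor K D) :
    tensorStar str a ∈ RedTensor K D := by
  induction ha using NonUnitalAlgebra.adjoin_induction with
  | mem x hx =>
    obtain ⟨v, rfl⟩ := hx
    rw [tensorStar_ι]
    exact NonUnitalAlgebra.subset_adjoin K ⟨_, rfl⟩
  | add x y _ _ hx hy => rw [map_add]; exact add_mem hx hy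
  | zero => rw [map_zero]; exact zero_mem _
  | mul x y _ _ hx hy => rw [tensorStar_mul]; exact mul_mem hy hx
  | smul r x _ hx => rw [map_smul]; exact SMulMemClass.smul_mem r hx

/-- The involution `(v₁ ⊗ ⋯ ⊗ vₙ)* = vₙ* ⊗ ⋯ ⊗ v₁*` of `T(D)`. -/
def RedTensor.inv (str : D →ₗ[K] D) : RedTensor K D →ₗ[K] RedTensor K D :=
  (tensorStar str).restrict (p := (RedTensor K D).toSubmodule)
    (q := (RedTensor K D).toSubmodule) (tensorStar_mem str)

end RedTensor

/-! ### The universal enveloping Rota-Baxter algebra of a dendriform algebra -/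

section Enveloping

variable {K D X : Type*} [Field K] [AddCommGroup D] [Module K D]

/-- The inclusion `D → T(D) → ϖ^{NC,0}(T(D))`. -/
def dendIncl (b : Module.Basis X K (RedTensor K D)) : D →ₗ[K] FreeRB b :=
  FreeRB.incl b ∘ₗ RedTensor.incl K

/-- The generators `x ≺ y - x⌊y⌋` and `x ≻ y - ⌊x⌋y`, for `x, y ∈ D`. -/
def envelopingRel (b : Module.Basis X K (RedTensor K D)) (prec succ : D →ₗ[K] D →ₗ[K] D) :
    Set (FreeRB b) :=
  {z | ∃ x y : D,
    z = dendIncl b (prec x y) - FreeRB.mul b (dendIncl b x) (FreeRB.op b (dendIncl b y)) ∨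
    z = dendIncl b (succ x y) - FreeRB.mul b (FreeRB.op b (dendIncl b x)) (dendIncl b y)}

/-- The Rota-Baxter ideal `J_R` of `ϖ^{NC,0}(T(D))`. -/
def envelopingIdeal (b : Module.Basis X K (RedTensor K D)) (prec succ : D →ₗ[K] D →ₗ[K] D) :
    Submodule K (FreeRB b) :=
  rotaBaxterIdealSpan (FreeRB.mul b) (FreeRB.op b) (envelopingRel b prec succ)

/-- The universal enveloping Rota-Baxter algebra `ϖ^{NC,0}(T(D)) / J_R`. -/
abbrev Enveloping (b : Module.Basis X K (RedTensor K D)) (prec succ : D →ₗ[K] D →ₗ[K] D) :=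
  FreeRB b ⧸ envelopingIdeal b prec succ

/-- The product of the universal enveloping Rota-Baxter algebra. -/
def Enveloping.mul (b : Module.Basis X K (RedTensor K D)) (prec succ : D →ₗ[K] D →ₗ[K] D) :
    Enveloping b prec succ →ₗ[K] Enveloping b prec succ →ₗ[K] Enveloping b prec succ :=
  quotientMul (isRotaBaxterIdeal_span (FreeRB.mul b) (FreeRB.op b) (envelopingRel b prec succ))

/-- The operator of the universal enveloping Rota-Baxter algebra. -/
def Enveloping.op (b : Module.Basis X K (RedTensor K D)) (prec succ : D →ₗ[K] D →ₗ[K] D) :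
    Enveloping b prec succ →ₗ[K] Enveloping b prec succ :=
  quotientOp (isRotaBaxterIdeal_span (FreeRB.mul b) (FreeRB.op b) (envelopingRel b prec succ))

end Enveloping

end

/-!
The Rota-Baxter words form an algebra that behaves like a free product of `B` and of the algebra
of bracketed elements `⌊a⌋`: concatenating letters of different kinds is associative by
construction, and letters of the same kind multiply inside a single letter. As the algebra is
generated by letters, associativity and `(x ⋄ y)* = y* ⋄ x*` need only be shown for all products
that start with a letter, and peeling off further letters reduces them to letters of one kind. In
`B` they hold by assumption. For bracketed letters the identity
`⌊u⌋ ⋄ ⌊v⌋ = ⌊u ⋄ ⌊v⌋ + ⌊u⌋ ⋄ v⌋` removes one pair of brackets from one of the factors, which makes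
a structural induction on each factor possible.

The involution exchanges the two families of generators of `J_R`, and the preimage of a Rota-Baxter
ideal under an involution is again a Rota-Baxter ideal, so `J_R` is stable.
-/

section RotaBaxter

variable {K A : Type*} [Field K] [AddCommGroup A] [Module K A] {μ : A →ₗ[K] A →ₗ[K] A}
  {R str : A →ₗ[K] A}

theorem rotaBaxter_mul_assoc (hR : ∀ a b, μ (R a) (R b) = R (μ a (R b) + μ (R a) b)) {a b c : A}
    (ha : μ (μ a (R b)) (R c) = μ a (μ (R b) (R c)))
    (hb : μ (μ (R a) b) (R c) = μ (R a) (μ b (R c)))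
    (hc : μ (μ (R a) (R b)) c = μ (R a) (μ (R b) c)) :
    μ (μ (R a) (R b)) (R c) = μ (R a) (μ (R b) (R c)) := by
  calc μ (μ (R a) (R b)) (R c)
      = R (μ (μ a (R b)) (R c) + μ (μ (R a) b) (R c) + μ (μ (R a) (R b)) c) := by
        rw [hR a b, hR _ c, ← hR a b, map_add μ, LinearMap.add_apply]
    _ = R (μ a (μ (R b) (R c)) + μ (R a) (μ b (R c) + μ (R b) c)) := by
        rw [ha, hb, hc, add_assoc, map_add (μ (R a))]
    _ = μ (R a) (μ (R b) (R c)) := by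
        rw [hR b c, hR a]

theorem subset_rotaBaxterIdealSpan (S : Set A) : S ⊆ rotaBaxterIdealSpan μ R S :=
  fun _ hx => Submodule.mem_sInf.2 fun _ hI => hI.2 hx

theorem rotaBaxterIdealSpan_le {S : Set A} {I : Submodule K A} (hI : IsRotaBaxterIdeal μ R I)
    (hS : S ⊆ I) : rotaBaxterIdealSpan μ R S ≤ I :=
  sInf_le ⟨hI, hS⟩

theorem IsRotaBaxterIdeal.comap_star {I : Submodule K A} (hI : IsRotaBaxterIdeal μ R I)
    (star_mul : ∀ a b, str (μ a b) = μ (str b) (str a)) (star_op : ∀ a, str (R a) = R (str a)) :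
    IsRotaBaxterIdeal μ R (I.comap str) where
  mul_left_mem a x hx := by
    rw [Submodule.mem_comap, star_mul]
    exact hI.mul_right_mem _ _ hx
  mul_right_mem a x hx := by
    rw [Submodule.mem_comap, star_mul]
    exact hI.mul_left_mem _ _ hx
  op_mem x hx := by
    rw [Submodule.mem_comap, star_op]
    exact hI.op_mem _ hx

theorem rotaBaxterIdealSpan_le_comap_star
    (star_mul : ∀ a b, str (μ a b) = μ (str b) (str a)) (star_op : ∀ a, str (R a) = R (str a))
    {S : Set A} (hS : ∀ x ∈ S, str x ∈ S) :
    rotaBaxterIdealSpan μ R S ≤ (rotaBaxterIdealSpan μ R S).comap str :=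
  rotaBaxterIdealSpan_le ((isRotaBaxterIdeal_span μ R S).comap_star star_mul star_op)
    fun x hx => subset_rotaBaxterIdealSpan S (hS x hx)

theorem IsRotaBaxterAlgebra.quotient (h : IsRotaBaxterAlgebra μ R) {I : Submodule K A}
    (hI : IsRotaBaxterIdeal μ R I) : IsRotaBaxterAlgebra (quotientMul hI) (quotientOp hI) where
  mul_assoc := I.mkQ_surjective.forall₃.2 fun a b c => congrArg I.mkQ (h.mul_assoc a b c)
  rotaBaxter := I.mkQ_surjective.forall₂.2 fun a b => congrArg I.mkQ (h.rotaBaxter a b)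

theorem IsInvolutiveRotaBaxterAlgebra.quotient (h : IsInvolutiveRotaBaxterAlgebra μ R str)
    {I : Submodule K A} (hI : IsRotaBaxterIdeal μ R I) (hstr : I ≤ I.comap str) :
    IsInvolutiveRotaBaxterAlgebra (quotientMul hI) (quotientOp hI) (I.mapQ I str hstr) where
  toIsRotaBaxterAlgebra := h.toIsRotaBaxterAlgebra.quotient hI
  star_star := I.mkQ_surjective.forall.2 fun a => congrArg I.mkQ (h.star_star a)
  star_mul := I.mkQ_surjective.forall₂.2 fun a b => congrArg I.mkQ (h.star_mul a b)
  star_op := I.mkQ_surjective.forall.2 fun a => congrArg I.mkQ (h.star_op a)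

theorem IsInvolutiveRotaBaxterAlgebra.existsUnique_quotient_star
    (h : IsInvolutiveRotaBaxterAlgebra μ R str) {I : Submodule K A} (hI : IsRotaBaxterIdeal μ R I)
    (hstr : I ≤ I.comap str) :
    ∃! s : (A ⧸ I) →ₗ[K] (A ⧸ I), (∀ a, s (I.mkQ a) = I.mkQ (str a)) ∧
      IsInvolutiveRotaBaxterAlgebra (quotientMul hI) (quotientOp hI) s :=
  ⟨I.mapQ I str hstr, ⟨fun _ => rfl, h.quotient hI hstr⟩,
    fun _ hs => Submodule.linearMap_qext I (LinearMap.ext hs.1)⟩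

end RotaBaxter

namespace FreeRB

section RotaBaxterWords

variable {K B X : Type*} [Field K] [NonUnitalRing B] [Module K B] (b : Module.Basis X K B)

local notation:70 x:70 " ⋄ " y:71 => mul b x y

/-- The Rota-Baxter word `w` as an element of the basis of `ϖ^{NC,0}(B)`. -/
noncomputable abbrev word {h : Bool} (w : RBWord X h) : FreeRB b := wordBasis b ⟨h, w⟩

/-- The inclusion into `ϖ^{NC,0}(B)` of the linear combinations of words with head `h`, the form in
which `RBWord.mul` returns its values. -/
noncomputable def ofHead (h : Bool) : (RBWord X h →₀ K) →ₗ[K] FreeRB b :=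
  Finsupp.linearCombination K (word b)

/-- The subspace of `ϖ^{NC,0}(B)` spanned by the words with head `h`. -/
noncomputable def headSpan (h : Bool) : Submodule K (FreeRB b) :=
  LinearMap.range (ofHead b h)

variable {b} in
@[elab_as_elim]
theorem word_induction {p : FreeRB b → Prop} (zero : p 0) (add : ∀ x y, p x → p y → p (x + y))
    (smul : ∀ (c : K) x, p x → p (c • x)) (word : ∀ {h : Bool} (w : RBWord X h), p (word b w))
    (a : FreeRB b) : p a := by
  induction (wordBasis b).mem_span a using Submodule.span_induction with
  | mem _ hx => obtain ⟨⟨h, w⟩, rfl⟩ := hx; exact word w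
  | zero => exact zero
  | add x y _ _ hx hy => exact add x y hx hy
  | smul c x _ hx => exact smul c x hx

variable {b} in
theorem eq_of_mem_headSpan {M : Type*} [AddCommGroup M] [Module K M] {f g : FreeRB b →ₗ[K] M}
    {h : Bool} (hfg : ∀ w : RBWord X h, f (word b w) = g (word b w)) {z : FreeRB b}
    (hz : z ∈ headSpan b h) : f z = g z := by
  rw [headSpan, ofHead, Finsupp.range_linearCombination] at hz
  exact LinearMap.eqOn_span (Set.forall_mem_range.2 hfg) hz

theorem op_word {h : Bool} (u : RBWord X h) : op b (word b u) = word b (.brak u) :=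
  (wordBasis b).constr_basis K _ _

theorem incl_basis (x : X) : incl b (b x) = word b (.var x) :=
  b.constr_basis K _ _

theorem word_mul_word {h h' : Bool} (x : RBWord X h) (y : RBWord X h') :
    word b x ⋄ word b y = ofHead b h (RBWord.mul b x y) := by
  simp only [mul, word, Module.Basis.constr_basis]
  rfl

theorem ofHead_single {h : Bool} (w : RBWord X h) : ofHead b h (.single w 1) = word b w := by
  rw [ofHead, Finsupp.linearCombination_single, one_smul]

theorem ofHead_mapDomain {ι M : Type*} [AddCommGroup M] [Module K M] {h : Bool} {v : ι → M}
    {f : ι → RBWord X h} (g : M →ₗ[K] FreeRB b) (hg : ∀ i, g (v i) = word b (f i)) (m : ι →₀ K) :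
    ofHead b h (m.mapDomain f) = g (Finsupp.linearCombination K v m) := by
  rw [ofHead, Finsupp.linearCombination_mapDomain, Finsupp.apply_linearCombination]
  congr 2
  exact funext fun i => (hg i).symm

theorem word_mem_headSpan {h : Bool} (w : RBWord X h) : word b w ∈ headSpan b h :=
  ⟨.single w 1, ofHead_single b w⟩

theorem word_mul_mem_headSpan {h : Bool} (w : RBWord X h) (a : FreeRB b) :
    word b w ⋄ a ∈ headSpan b h := by
  induction a using word_induction with
  | zero => rw [map_zero]; exact zero_mem _
  | add x y hx hy => rw [map_add]; exact add_mem hx hy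
  | smul c x hx => rw [map_smul]; exact Submodule.smul_mem _ _ hx
  | word y => exact ⟨_, (word_mul_word b w y).symm⟩

theorem incl_mul_word (x : X) (w : RBWord X true) :
    incl b (b x) ⋄ word b w = word b (.varCons x w) := by
  rw [incl_basis, word_mul_word, RBWord.mul, ofHead_single]

theorem op_mul_word {h : Bool} (u : RBWord X h) (w : RBWord X false) :
    op b (word b u) ⋄ word b w = word b (.brakCons u w) := by
  rw [op_word, word_mul_word, RBWord.mul, ofHead_single]

variable {b}

section Induction

variable {p : FreeRB b → Prop}

@[elab_as_elim]
theorem cases_head_incl (zero : p 0) (add : ∀ x y, p x → p y → p (x + y))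
    (smul : ∀ (c : K) x, p x → p (c • x)) (incl : ∀ a, p (incl b a))
    (incl_mul : ∀ a (w : RBWord X true), p (FreeRB.incl b a ⋄ word b w))
    (word_true : ∀ w : RBWord X true, p (word b w)) (a : FreeRB b) : p a := by
  induction a using word_induction with
  | zero => exact zero
  | add x y hx hy => exact add x y hx hy
  | smul c x hx => exact smul c x hx
  | @word h w =>
    cases w with
    | var x => exact incl_basis b x ▸ incl (b x)
    | varCons x w => exact incl_mul_word b x w ▸ incl_mul (b x) w
    | brak u => exact word_true _
    | brakCons u w => exact word_true _

@[elab_as_elim]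
theorem induction_head_op (zero : p 0) (add : ∀ x y, p x → p y → p (x + y))
    (smul : ∀ (c : K) x, p x → p (c • x)) (op : ∀ a, p a → p (op b a))
    (op_mul : ∀ a (w : RBWord X false), p a → p (FreeRB.op b a ⋄ word b w))
    (word_false : ∀ w : RBWord X false, p (word b w)) (a : FreeRB b) : p a := by
  induction a using word_induction with
  | zero => exact zero
  | add x y hx hy => exact add x y hx hy
  | smul c x hx => exact smul c x hx
  | @word h w =>
    induction w with
    | brak u hu => exact op_word b u ▸ op _ hu
    | brakCons u w hu => exact op_mul_word b u w ▸ op_mul _ w hu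
    | var x => exact word_false _
    | varCons x w => exact word_false _

@[elab_as_elim]
theorem induction_generators (zero : p 0) (add : ∀ x y, p x → p y → p (x + y))
    (smul : ∀ (c : K) x, p x → p (c • x)) (incl : ∀ a, p (incl b a)) (op : ∀ a, p a → p (op b a))
    (mul : ∀ x y, p x → p y → p (x ⋄ y)) (a : FreeRB b) : p a := by
  induction a using word_induction with
  | zero => exact zero
  | add x y hx hy => exact add x y hx hy
  | smul c x hx => exact smul c x hx
  | @word h w =>
    induction w with
    | var x => exact incl_basis b x ▸ incl (b x)
    | brak u hu => exact op_word b u ▸ op _ hu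
    | varCons x w hw => exact incl_mul_word b x w ▸ mul _ _ (incl (b x)) hw
    | brakCons u w hu hw => exact op_mul_word b u w ▸ mul _ _ (op _ hu) hw

end Induction

section Associativity

theorem op_mul_op (a a' : FreeRB b) :
    op b a ⋄ op b a' = op b (a ⋄ op b a' + op b a ⋄ a') := by
  suffices (mul b).compl₁₂ (op b) (op b) = ((mul b).compl₂ (op b) + mul b ∘ₗ op b).compr₂ (op b)
    from LinearMap.congr_fun₂ this a a'
  refine LinearMap.ext_basis (wordBasis b) (wordBasis b) fun ⟨h, u⟩ ⟨h', v⟩ => ?_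
  change op b (word b u) ⋄ op b (word b v) =
    op b (word b u ⋄ op b (word b v) + op b (word b u) ⋄ word b v)
  rw [op_word, op_word, word_mul_word, RBWord.mul, map_add, ofHead_mapDomain b (op b) (op_word b),
    ofHead_mapDomain b (op b) (op_word b), ← map_add, add_comm, word_mul_word, word_mul_word]
  rfl

theorem op_mul_word_mul (a : FreeRB b) (w : RBWord X false) (c : FreeRB b) :
    (op b a ⋄ word b w) ⋄ c = op b a ⋄ (word b w ⋄ c) := by
  suffices mul b ∘ₗ (mul b).flip (word b w) ∘ₗ op b =
      (mul b).compl₁₂ (op b) (mul b (word b w)) from LinearMap.congr_fun₂ this a c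
  refine LinearMap.ext_basis (wordBasis b) (wordBasis b) fun ⟨h, u⟩ ⟨h', y⟩ => ?_
  change (op b (word b u) ⋄ word b w) ⋄ word b y = op b (word b u) ⋄ (word b w ⋄ word b y)
  rw [op_mul_word, word_mul_word, RBWord.mul, word_mul_word]
  exact ofHead_mapDomain b (mul b (op b (word b u))) (op_mul_word b u) _

theorem incl_mul_word_mul (a : B) (w : RBWord X true) (c : FreeRB b) :
    (incl b a ⋄ word b w) ⋄ c = incl b a ⋄ (word b w ⋄ c) := by
  suffices mul b ∘ₗ (mul b).flip (word b w) ∘ₗ incl b =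
      (mul b).compl₁₂ (incl b) (mul b (word b w)) from LinearMap.congr_fun₂ this a c
  refine LinearMap.ext_basis b (wordBasis b) fun x ⟨h, y⟩ => ?_
  change (incl b (b x) ⋄ word b w) ⋄ word b y = incl b (b x) ⋄ (word b w ⋄ word b y)
  rw [incl_mul_word, word_mul_word, RBWord.mul, word_mul_word]
  exact ofHead_mapDomain b (mul b (incl b (b x))) (incl_mul_word b x) _

theorem op_mul_op_mul (a a' : FreeRB b) {z : FreeRB b} (hz : z ∈ headSpan b false) :
    (op b a ⋄ op b a') ⋄ z = op b a ⋄ (op b a' ⋄ z) := by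
  refine eq_of_mem_headSpan (f := mul b (op b a ⋄ op b a')) (g := mul b (op b a) ∘ₗ mul b _)
    (fun w => ?_) hz
  suffices ((mul b).compl₁₂ (op b) (op b)).compr₂ ((mul b).flip (word b w)) =
      (mul b).compl₁₂ (op b) ((mul b).flip (word b w) ∘ₗ op b) from
    LinearMap.congr_fun₂ this a a'
  refine LinearMap.ext_basis (wordBasis b) (wordBasis b) fun ⟨h, u⟩ ⟨h', v⟩ => ?_
  change (op b (word b u) ⋄ op b (word b v)) ⋄ word b w =
    op b (word b u) ⋄ (op b (word b v) ⋄ word b w)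
  have op_mul_w {k : Bool} (z : RBWord X k) :
      ((mul b).flip (word b w) ∘ₗ op b) (word b z) = word b (.brakCons z w) := op_mul_word b z w
  rw [op_mul_op, op_mul_word, op_word, op_word, word_mul_word b (.brak u) (.brakCons v w),
    RBWord.mul, map_add (ofHead b true), ofHead_mapDomain b _ op_mul_w,
    ofHead_mapDomain b _ op_mul_w, ← map_add, add_comm, word_mul_word, word_mul_word]
  rfl

theorem op_mul_assoc {a : FreeRB b} (ha : ∀ y z, (a ⋄ y) ⋄ z = a ⋄ (y ⋄ z)) (y z : FreeRB b) :
    (op b a ⋄ y) ⋄ z = op b a ⋄ (y ⋄ z) := by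
  induction y using induction_head_op generalizing z with
  | zero | add | smul => simp_all
  | word_false w => exact op_mul_word_mul a w z
  | op_mul a' w =>
    rw [← op_mul_op_mul a a' (word_mem_headSpan b w), op_mul_op, op_mul_word_mul,
      op_mul_word_mul, ← op_mul_op, op_mul_op_mul a a' (word_mul_mem_headSpan b w z)]
  | op a' ha' =>
    have op_step (c : FreeRB b) (hc : (op b a ⋄ op b a') ⋄ c = op b a ⋄ (op b a' ⋄ c)) :
        (op b a ⋄ op b a') ⋄ op b c = op b a ⋄ (op b a' ⋄ op b c) :=
      rotaBaxter_mul_assoc op_mul_op (ha _ _) (ha' _) hc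
    induction z using induction_head_op with
    | zero | add | smul => simp_all
    | word_false w => exact op_mul_op_mul a a' (word_mem_headSpan b w)
    | op c hc => exact op_step c hc
    | op_mul c w hc =>
      have hw := word_mem_headSpan b w
      calc (op b a ⋄ op b a') ⋄ (op b c ⋄ word b w)
          = ((op b a ⋄ op b a') ⋄ op b c) ⋄ word b w := by
            rw [op_mul_op a, op_mul_op_mul _ _ hw]
        _ = (op b a ⋄ (op b a' ⋄ op b c)) ⋄ word b w := by
            rw [op_step c hc]
        _ = op b a ⋄ (op b a' ⋄ (op b c ⋄ word b w)) := by
            rw [← op_mul_op_mul a' c hw, op_mul_op a' c, op_mul_op_mul _ _ hw]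

variable [IsScalarTower K B B] [SMulCommClass K B B]

theorem incl_mul_incl (a a' : B) : incl b a ⋄ incl b a' = incl b (a * a') := by
  suffices (mul b).compl₁₂ (incl b) (incl b) = (LinearMap.mul K B).compr₂ (incl b) from
    LinearMap.congr_fun₂ this a a'
  refine LinearMap.ext_basis b b fun x y => ?_
  change incl b (b x) ⋄ incl b (b y) = incl b (b x * b y)
  rw [incl_basis, incl_basis, word_mul_word, RBWord.mul,
    ofHead_mapDomain b (incl b) (incl_basis b), b.linearCombination_repr]

theorem incl_mul_incl_mul (a a' : B) {z : FreeRB b} (hz : z ∈ headSpan b true) :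
    (incl b a ⋄ incl b a') ⋄ z = incl b a ⋄ (incl b a' ⋄ z) := by
  refine eq_of_mem_headSpan (f := mul b (incl b a ⋄ incl b a'))
    (g := mul b (incl b a) ∘ₗ mul b _) (fun w => ?_) hz
  suffices ((mul b).compl₁₂ (incl b) (incl b)).compr₂ ((mul b).flip (word b w)) =
      (mul b).compl₁₂ (incl b) ((mul b).flip (word b w) ∘ₗ incl b) from
    LinearMap.congr_fun₂ this a a'
  refine LinearMap.ext_basis b b fun x y => ?_
  change (incl b (b x) ⋄ incl b (b y)) ⋄ word b w = incl b (b x) ⋄ (incl b (b y) ⋄ word b w)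
  rw [incl_mul_incl, incl_mul_word, incl_basis, word_mul_word, RBWord.mul,
    ofHead_mapDomain b ((mul b).flip (word b w) ∘ₗ incl b) (fun z => incl_mul_word b z w),
    b.linearCombination_repr]
  rfl

theorem incl_mul_assoc (a : B) (y z : FreeRB b) :
    (incl b a ⋄ y) ⋄ z = incl b a ⋄ (y ⋄ z) := by
  induction y using cases_head_incl with
  | zero | add | smul => simp_all
  | word_true w => exact incl_mul_word_mul a w z
  | incl_mul a' w =>
    rw [← incl_mul_incl_mul a a' (word_mem_headSpan b w), incl_mul_incl, incl_mul_word_mul,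
      incl_mul_word_mul, ← incl_mul_incl, incl_mul_incl_mul a a' (word_mul_mem_headSpan b w z)]
  | incl a' =>
    induction z using cases_head_incl with
    | zero | add | smul => simp_all
    | word_true w => exact incl_mul_incl_mul a a' (word_mem_headSpan b w)
    | incl a'' => simp only [incl_mul_incl, mul_assoc]
    | incl_mul a'' w =>
      have hw := word_mem_headSpan b w
      simp only [incl_mul_incl, ← incl_mul_incl_mul _ _ hw, mul_assoc]

theorem mul_mul_assoc (x y z : FreeRB b) : (x ⋄ y) ⋄ z = x ⋄ (y ⋄ z) := by
  induction x using induction_generators generalizing y z with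
  | zero | add | smul => simp_all
  | incl a => exact incl_mul_assoc a y z
  | op a ha => exact op_mul_assoc ha y z
  | mul x x' hx hx' => rw [hx, hx, hx', hx]

variable (b) in
theorem isRotaBaxterAlgebra : IsRotaBaxterAlgebra (mul b) (op b) :=
  ⟨mul_mul_assoc, op_mul_op⟩

end Associativity

section Involution

variable {σ : B →ₗ[K] B}

theorem inv_word {h : Bool} (w : RBWord X h) : inv b σ (word b w) = wordStar b σ w :=
  (wordBasis b).constr_basis K _ _

theorem inv_incl (a : B) : inv b σ (incl b a) = incl b (σ a) := by
  suffices inv b σ ∘ₗ incl b = incl b ∘ₗ σ from LinearMap.congr_fun this a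
  refine b.ext fun x => ?_
  rw [LinearMap.comp_apply, incl_basis, inv_word, wordStar, LinearMap.comp_apply]

theorem inv_op (a : FreeRB b) : inv b σ (op b a) = op b (inv b σ a) := by
  induction a using word_induction with
  | zero | add | smul => simp_all
  | word w => rw [op_word, inv_word, inv_word, wordStar]

theorem inv_incl_mul_word (a : B) (w : RBWord X true) :
    inv b σ (incl b a ⋄ word b w) = inv b σ (word b w) ⋄ inv b σ (incl b a) := by
  suffices inv b σ ∘ₗ (mul b).flip (word b w) ∘ₗ incl b =
      mul b (inv b σ (word b w)) ∘ₗ inv b σ ∘ₗ incl b from LinearMap.congr_fun this a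
  refine b.ext fun x => ?_
  change inv b σ (incl b (b x) ⋄ word b w) = inv b σ (word b w) ⋄ inv b σ (incl b (b x))
  rw [incl_mul_word, inv_word, inv_word, wordStar, inv_incl]

theorem inv_op_mul_word (a : FreeRB b) (w : RBWord X false) :
    inv b σ (op b a ⋄ word b w) = inv b σ (word b w) ⋄ inv b σ (op b a) := by
  induction a using word_induction with
  | zero | add | smul => simp_all
  | word u => rw [op_mul_word, inv_word, inv_word, wordStar, inv_op, inv_word]

variable [IsScalarTower K B B] [SMulCommClass K B B]

theorem inv_incl_mul (hσ : ∀ x y, σ (x * y) = σ y * σ x) (a : B) (y : FreeRB b) :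
    inv b σ (incl b a ⋄ y) = inv b σ y ⋄ inv b σ (incl b a) := by
  have inv_incl_mul_incl (a' : B) : inv b σ (incl b a ⋄ incl b a') =
      inv b σ (incl b a') ⋄ inv b σ (incl b a) := by
    simp only [incl_mul_incl, inv_incl, hσ]
  induction y using cases_head_incl with
  | zero | add | smul => simp_all
  | word_true w => exact inv_incl_mul_word a w
  | incl a' => exact inv_incl_mul_incl a'
  | incl_mul a' w =>
    rw [← mul_mul_assoc, incl_mul_incl, inv_incl_mul_word, ← incl_mul_incl, inv_incl_mul_incl,
      ← mul_mul_assoc, ← inv_incl_mul_word]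

theorem inv_op_mul {a : FreeRB b} (ha : ∀ y, inv b σ (a ⋄ y) = inv b σ y ⋄ inv b σ a)
    (y : FreeRB b) : inv b σ (op b a ⋄ y) = inv b σ y ⋄ inv b σ (op b a) := by
  have op_step (a' : FreeRB b)
      (ha' : inv b σ (op b a ⋄ a') = inv b σ a' ⋄ inv b σ (op b a)) :
      inv b σ (op b a ⋄ op b a') = inv b σ (op b a') ⋄ inv b σ (op b a) := by
    simp only [inv_op] at ha ha' ⊢
    rw [op_mul_op, op_mul_op, inv_op, map_add, ha, ha', inv_op, add_comm]
  induction y using induction_head_op with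
  | zero | add | smul => simp_all
  | word_false w => exact inv_op_mul_word a w
  | op a' ha' => exact op_step a' ha'
  | op_mul a' w ha' =>
    rw [← mul_mul_assoc, op_mul_op, inv_op_mul_word, ← op_mul_op, op_step a' ha',
      ← mul_mul_assoc, ← inv_op_mul_word]

theorem inv_mul (hσ : ∀ x y, σ (x * y) = σ y * σ x) (x y : FreeRB b) :
    inv b σ (x ⋄ y) = inv b σ y ⋄ inv b σ x := by
  induction x using induction_generators generalizing y with
  | zero | add | smul => simp_all
  | incl a => exact inv_incl_mul hσ a y
  | op a ha => exact inv_op_mul ha y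
  | mul x x' hx hx' => rw [mul_mul_assoc, hx, hx', hx, mul_mul_assoc]

theorem inv_inv (hσ : ∀ x y, σ (x * y) = σ y * σ x) (hσσ : ∀ x, σ (σ x) = x) (a : FreeRB b) :
    inv b σ (inv b σ a) = a := by
  induction a using induction_generators with
  | zero | add | smul => simp_all
  | incl a => rw [inv_incl, inv_incl, hσσ]
  | op a ha => rw [inv_op, inv_op, ha]
  | mul x y hx hy => rw [inv_mul hσ, inv_mul hσ, hx, hy]

variable (b) in
theorem isInvolutiveRotaBaxterAlgebra (hσ : ∀ x y, σ (x * y) = σ y * σ x)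
    (hσσ : ∀ x, σ (σ x) = x) : IsInvolutiveRotaBaxterAlgebra (mul b) (op b) (inv b σ) where
  toIsRotaBaxterAlgebra := isRotaBaxterAlgebra b
  star_star := inv_inv hσ hσσ
  star_mul := inv_mul hσ
  star_op := inv_op

end Involution

end RotaBaxterWords

end FreeRB

section Enveloping

variable {K D X : Type*} [Field K] [AddCommGroup D] [Module K D] {str : D →ₗ[K] D}

theorem tensorStar_tensorStar (hstar : ∀ v, str (str v) = v) (a : TensorAlgebra K D) :
    tensorStar str (tensorStar str a) = a := by
  induction a using TensorAlgebra.induction with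
  | algebraMap r => simp [tensorStar]
  | ι v => rw [tensorStar_ι, tensorStar_ι, hstar]
  | mul x y hx hy => rw [tensorStar_mul, tensorStar_mul, hx, hy]
  | add x y hx hy => rw [map_add, map_add, hx, hy]

theorem RedTensor.inv_inv (hstar : ∀ v, str (str v) = v) (x : RedTensor K D) :
    RedTensor.inv str (RedTensor.inv str x) = x :=
  Subtype.ext (tensorStar_tensorStar hstar x)

theorem RedTensor.inv_mul (x y : RedTensor K D) :
    RedTensor.inv str (x * y) = RedTensor.inv str y * RedTensor.inv str x :=
  Subtype.ext (tensorStar_mul str x y)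

theorem RedTensor.inv_incl (v : D) :
    RedTensor.inv str (RedTensor.incl K v) = RedTensor.incl K (str v) :=
  Subtype.ext (tensorStar_ι str v)

theorem inv_dendIncl (b : Module.Basis X K (RedTensor K D)) (v : D) :
    FreeRB.inv b (RedTensor.inv str) (dendIncl b v) = dendIncl b (str v) := by
  rw [dendIncl, LinearMap.comp_apply, FreeRB.inv_incl, RedTensor.inv_incl, LinearMap.comp_apply]

theorem star_succ_of_star_prec {prec succ : D →ₗ[K] D →ₗ[K] D} (hstar : ∀ a, str (str a) = a)
    (hprec : ∀ a c, str (prec a c) = succ (str c) (str a)) (a c : D) :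
    str (succ a c) = prec (str c) (str a) := by
  rw [← hstar (prec _ _), hprec, hstar, hstar]

theorem inv_mem_envelopingRel (b : Module.Basis X K (RedTensor K D))
    {prec succ : D →ₗ[K] D →ₗ[K] D} (hstar : ∀ a, str (str a) = a)
    (hprec : ∀ a c, str (prec a c) = succ (str c) (str a)) :
    ∀ z ∈ envelopingRel b prec succ,
      FreeRB.inv b (RedTensor.inv str) z ∈ envelopingRel b prec succ := by
  rintro _ ⟨x, y, rfl | rfl⟩
  · refine ⟨str y, str x, .inr ?_⟩
    simp only [map_sub, FreeRB.inv_mul RedTensor.inv_mul, FreeRB.inv_op, inv_dendIncl, hprec]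
  · refine ⟨str y, str x, .inl ?_⟩
    simp only [map_sub, FreeRB.inv_mul RedTensor.inv_mul, FreeRB.inv_op, inv_dendIncl,
      star_succ_of_star_prec hstar hprec]

end Enveloping

theorem mainTheorem7_general {K D X : Type*} [Field K] [AddCommGroup D] [Module K D]
    (prec succ : D →ₗ[K] D →ₗ[K] D) (str : D →ₗ[K] D)
    (hstar : ∀ a, str (str a) = a) (hprec : ∀ a c, str (prec a c) = succ (str c) (str a))
    (b : Module.Basis X K (RedTensor K D)) :
    IsInvolutiveRotaBaxterAlgebra (FreeRB.mul b) (FreeRB.op b)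
        (FreeRB.inv b (RedTensor.inv str)) ∧
      (∀ z ∈ envelopingIdeal b prec succ,
        FreeRB.inv b (RedTensor.inv str) z ∈ envelopingIdeal b prec succ) ∧
      ∃! s : Enveloping b prec succ →ₗ[K] Enveloping b prec succ,
        (∀ z : FreeRB b, s ((envelopingIdeal b prec succ).mkQ z) =
          (envelopingIdeal b prec succ).mkQ (FreeRB.inv b (RedTensor.inv str) z)) ∧
        IsInvolutiveRotaBaxterAlgebra (Enveloping.mul b prec succ) (Enveloping.op b prec succ)
          s := by
  have free_involutive := FreeRB.isInvolutiveRotaBaxterAlgebra b RedTensor.inv_mul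
    (RedTensor.inv_inv hstar)
  have ideal_stable := rotaBaxterIdealSpan_le_comap_star free_involutive.star_mul
    free_involutive.star_op (inv_mem_envelopingRel b hstar hprec)
  exact ⟨free_involutive, ideal_stable,
    free_involutive.existsUnique_quotient_star (isRotaBaxterIdeal_span _ _ _) ideal_stable⟩

theorem mainTheorem7 {K D X : Type*} [Field K] [CharZero K] [AddCommGroup D] [Module K D]
    (prec succ : D →ₗ[K] D →ₗ[K] D) (str : D →ₗ[K] D)
    (hD : IsInvolutiveDendriform prec succ str)
    (b : Module.Basis X K (RedTensor K D)) :
    IsInvolutiveRotaBaxterAlgebra (FreeRB.mul b) (FreeRB.op b)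
        (FreeRB.inv b (RedTensor.inv str)) ∧
      (∀ z ∈ envelopingIdeal b prec succ,
        FreeRB.inv b (RedTensor.inv str) z ∈ envelopingIdeal b prec succ) ∧
      ∃! s : Enveloping b prec succ →ₗ[K] Enveloping b prec succ,
        (∀ z : FreeRB b, s ((envelopingIdeal b prec succ).mkQ z) =
          (envelopingIdeal b prec succ).mkQ (FreeRB.inv b (RedTensor.inv str) z)) ∧
        IsInvolutiveRotaBaxterAlgebra (Enveloping.mul b prec succ) (Enveloping.op b prec succ)
          s :=
  mainTheorem7_general prec succ str hD.star_star hD.star_prec b
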